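/- Let $D$ be a compact connected Riemann surface with a Riemannian metric compatible with its complex structure, with area measure $dA$, and let $K_D$ be its canonical bundle. Let $N\to D$ be a holomorphic line bundle with a smooth Hermitian metric $\langle\cdot,\cdot\rangle$, let $(\cdot,\cdot)=\operatorname{Re}\langle\cdot,\cdot\rangle$ on $N$ and on $\overline{K}_D\otimes N$ (with the induced metric), let $J$ denote multiplication by $i$ on either bundle, and let $\Omega^0(N)$ and $\Omega^{0,1}(N)$ be the spaces of smooth sections of $N$ and of $\overline{K}_D\otimes N$. Let $\bar\partial:\Omega^0(N)\to\Omega^{0,1}(N)$ be the Cauchy--Riemann operator of $N$ and let $\bar\partial^*$ be its formal $L^2$-adjoint, i.e. $\int_D(\bar\partial\zeta,\alpha)\,dA=\int_D(\zeta,\bar\partial^*\alpha)\,dA$ for all $\zeta\in\Omega^0(N)$ and $\alpha\in\Omega^{0,1}(N)$. Let $\varphi$ be a holomorphic section of $K_D\otimes(N^*)^2$ that is not identically zero, and let $R:N\to\overline{K}_D\otimes N$ be a smooth real-linear bundle map which, together with its pointwise adjoint $R^*$ with respect to $(\cdot,\cdot)$, satisfies $$\text{(a)}\ \ RJ=-JR,\qquad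 \text{(b)}\ \ R^*R=|\varphi|^2\,\mathrm{Id},\qquad \text{(c)}\ \ \bar\partial^*R+R^*\bar\partial=0 .$$ Then for every real $t\neq0$ the operator $L_t=\bar\partial+tR:\Omega^0(N)\to\Omega^{0,1}(N)$ has $\ker L_t=0$. -/

import Mathlib

open Bundle MeasureTheory
open scoped Manifold ContDiff ComplexConjugate

noncomputable section

set_option linter.unusedSectionVars false

namespace AntilinearDbar

/-! ### Real-smooth sections, Hermitian metrics, frames -/

section Basic

variable {D : Type*} [TopologicalSpace D] [ChartedSpace ℂ D]
  {E : D → Type*} [∀ x, AddCommGroup (E x)] [∀ x, Module ℂ (E x)]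
  [TopologicalSpace (TotalSpace ℂ E)] [∀ x, TopologicalSpace (E x)] [FiberBundle ℂ E]

/-- `Ω⁰(E)`: the section `ξ` is smooth in the real sense. -/
def IsSmoothSection (ξ : ∀ x, E x) : Prop :=
  ContMDiff 𝓘(ℝ, ℂ) (𝓘(ℝ, ℂ).prod 𝓘(ℝ, ℂ)) ∞ (fun x => TotalSpace.mk' ℂ x (ξ x))

variable (E) in
/-- A smooth Hermitian metric `⟨u, v⟩` on the complex line bundle `E`, linear in the first and
conjugate-linear in the second variable. Smoothness is smoothness of `u ↦ ⟨u, u⟩` on the total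
space. For `E` the holomorphic tangent bundle of a Riemann surface, this is the same as a
Riemannian metric `Re ⟨u, v⟩` compatible with the complex structure. -/
structure HermitianMetric where
  inner : ∀ x, E x →ₗ[ℂ] E x →ₗ⋆[ℂ] ℂ
  conj_symm : ∀ x u v, conj (inner x u v) = inner x v u
  pos : ∀ x u, u ≠ 0 → 0 < (inner x u u).re
  smooth : ContMDiff (𝓘(ℝ, ℂ).prod 𝓘(ℝ, ℂ)) 𝓘(ℝ, ℝ) ∞
    (fun u : TotalSpace ℂ E => (inner u.1 u.2 u.2).re)

/-- `|u|²`. -/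
def HermitianMetric.normSq (h : HermitianMetric E) (x : D) (u : E x) : ℝ := (h.inner x u u).re

/-- The positive definite real inner product `(u, v) = Re ⟨u, v⟩`. -/
def HermitianMetric.re (h : HermitianMetric E) (x : D) (u v : E x) : ℝ := (h.inner x u v).re

variable [VectorBundle ℂ ℂ E]

variable (E) in
/-- The local frame of the line bundle `E` given by the preferred trivialization at `x`, at the
point `y`. -/
def localFrame (x y : D) : E y := (trivializationAt ℂ E x).symmL ℂ y 1

variable (E) in
/-- A nonzero vector in the fibre of the line bundle `E` over `x`. -/
def frame (x : D) : E x := localFrame E x x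

lemma frame_ne_zero (x : D) : frame E x ≠ 0 := by
  intro h0
  have hx := FiberBundle.mem_baseSet_trivializationAt' (F := ℂ) (E := E) x
  have h1 := (trivializationAt ℂ E x).continuousLinearMapAt_symmL (R := ℂ) hx 1
  have h2 : (trivializationAt ℂ E x).symmL ℂ x 1 = 0 := h0
  rw [h2, map_zero] at h1
  exact zero_ne_one h1

/-- The fibres of `E` are complex lines, spanned by any nonzero vector. -/
lemma exists_eq_smul (x : D) {v : E x} (hv : v ≠ 0) (w : E x) : ∃ c : ℂ, w = c • v := by
  have hx := FiberBundle.mem_baseSet_trivializationAt' (F := ℂ) (E := E) x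
  let L := (trivializationAt ℂ E x).continuousLinearEquivAt ℂ x hx
  have h0 : L v ≠ 0 := by simpa using hv
  refine ⟨L w / L v, L.injective ?_⟩
  rw [map_smul, smul_eq_mul, div_mul_cancel₀ _ h0]

lemma HermitianMetric.inner_self (h : HermitianMetric E) (x : D) (u : E x) :
    h.inner x u u = (h.normSq x u : ℂ) := by
  have := Complex.conj_eq_iff_real.1 (h.conj_symm x u u)
  obtain ⟨r, hr⟩ := this
  simp [HermitianMetric.normSq, hr]

lemma HermitianMetric.normSq_smul (h : HermitianMetric E) (x : D) (c : ℂ) (u : E x) :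
    h.normSq x (c • u) = ‖c‖ ^ 2 * h.normSq x u := by
  have : ((h.normSq x (c • u) : ℝ) : ℂ) = ((‖c‖ ^ 2 * h.normSq x u : ℝ) : ℂ) := by
    rw [← h.inner_self]
    simp only [map_smul, map_smulₛₗ, LinearMap.smul_apply, smul_eq_mul, h.inner_self]
    push_cast
    rw [← Complex.mul_conj']
    ring
  exact_mod_cast this

end Basic

/-! ### `(0,1)`-forms with values in a holomorphic line bundle and the operator `∂̄` -/

section Forms

variable {D : Type*} [TopologicalSpace D] [ChartedSpace ℂ D] [IsManifold 𝓘(ℂ) ω D]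
  {E : D → Type*} [∀ x, AddCommGroup (E x)] [∀ x, Module ℂ (E x)]
  [TopologicalSpace (TotalSpace ℂ E)] [∀ x, TopologicalSpace (E x)] [FiberBundle ℂ E]
  [VectorBundle ℂ ℂ E] [∀ x, IsTopologicalAddGroup (E x)] [∀ x, ContinuousSMul ℂ (E x)]

variable (E) in
/-- The fibre at `x` of `K̄_D ⊗ E = Λ^{0,1} T^*D ⊗ E`: conjugate-linear maps `T_x D → E_x`. -/
abbrev Form01 (x : D) : Type _ := TangentSpace 𝓘(ℂ) x →SL[starRingEnd ℂ] E x

variable (E) in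
/-- The fibre at `x` of `K_D ⊗ (E^*)²`: complex multilinear maps `T_x D × E_x × E_x → ℂ`. -/
abbrev CanonicalTwist (x : D) : Type _ :=
  TangentSpace 𝓘(ℂ) x →ₗ[ℂ] E x →ₗ[ℂ] E x →ₗ[ℂ] ℂ

variable (E) in
/-- `φ` is a holomorphic section of `K_D ⊗ (E^*)²`: in the local holomorphic coordinate `z` and the
local holomorphic frame `ν` of `E` around each point `p`, its coefficient `φ(∂_z, ν, ν)` is a
holomorphic function. -/
def IsHolomorphicTwist (φ : ∀ x : D, CanonicalTwist E x) : Prop :=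
  ∀ p : D, MDifferentiableOn 𝓘(ℂ) 𝓘(ℂ)
    (fun y => φ y (localFrame (fun x : D => TangentSpace 𝓘(ℂ) x) p y)
      (localFrame E p y) (localFrame E p y))
    ((chartAt ℂ p).source ∩ (trivializationAt ℂ E p).baseSet)

/-- The conjugate-linear part `v ↦ (L v + i L (i v)) / 2` of a real-linear map `L : ℂ → ℂ`. -/
def antilinearPart (L : ℂ →L[ℝ] ℂ) : ℂ →SL[starRingEnd ℂ] ℂ where
  toFun v := (L v + Complex.I * L (Complex.I * v)) / 2
  map_add' v w := by simp only [mul_add, map_add]; ring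
  map_smul' c v := by
    have key : ∀ z : ℂ, L z = z.re * L 1 + z.im * L Complex.I := fun z => by
      conv_lhs => rw [← Complex.re_add_im z]
      rw [map_add, show (z.re : ℂ) = z.re • (1 : ℂ) by simp,
        show (z.im : ℂ) * Complex.I = z.im • Complex.I by simp, map_smul, map_smul]
      simp
    rw [key (c • v), key (Complex.I * c • v), key v, key (Complex.I * v)]
    apply Complex.ext <;> simp <;> ring
  cont := by fun_prop

/-- The `∂̄`-operator of the holomorphic line bundle `E`. At `x`, write `ξ = f ν` with `ν` the
holomorphic frame of the preferred trivialization at `x`; then `∂̄ξ = (∂̄f) ν`, where `∂̄f` is the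
conjugate-linear part of the real differential of `f`. -/
def dbar (ξ : ∀ x, E x) (x : D) : Form01 E x :=
  ((trivializationAt ℂ E x).symmL ℂ x).comp
    (antilinearPart (mfderiv 𝓘(ℝ, ℂ) 𝓘(ℝ, ℂ)
      (fun y => (trivializationAt ℂ E x (TotalSpace.mk' ℂ y (ξ y))).2) x))

/-- The Hermitian inner product on the fibre of `K̄_D ⊗ E` at `x` induced by the metrics `g` on `D`
and `h` on `E`: it is `⟨A v, B v⟩ / |v|²` for any `v ≠ 0` in `T_x D`. -/
def formInner (g : HermitianMetric (fun x : D => TangentSpace 𝓘(ℂ) x)) (h : HermitianMetric E)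
    (x : D) (A B : Form01 E x) : ℂ :=
  let v := frame (fun x : D => TangentSpace 𝓘(ℂ) x) x
  h.inner x (A v) (B v) / g.normSq x v

lemma formInner_eq (g : HermitianMetric (fun x : D => TangentSpace 𝓘(ℂ) x))
    (h : HermitianMetric E) (x : D) (A B : Form01 E x) (v : TangentSpace 𝓘(ℂ) x) (hv : v ≠ 0) :
    formInner g h x A B = h.inner x (A v) (B v) / g.normSq x v := by
  obtain ⟨c, hc⟩ := exists_eq_smul (E := fun x : D => TangentSpace 𝓘(ℂ) x) x
    (frame_ne_zero (E := fun x : D => TangentSpace 𝓘(ℂ) x) x) v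
  have hc0 : c ≠ 0 := by rintro rfl; exact hv (by rw [hc, zero_smul])
  have hg : g.normSq x (frame (fun x : D => TangentSpace 𝓘(ℂ) x) x) ≠ 0 :=
    (g.pos x _ (frame_ne_zero (E := fun x : D => TangentSpace 𝓘(ℂ) x) x)).ne'
  have hn : ((‖c‖ : ℝ) : ℂ) ≠ 0 := by simpa using hc0
  rw [hc, g.normSq_smul]
  simp only [formInner, map_smulₛₗ, LinearMap.smul_apply, smul_eq_mul, RingHomCompTriple.comp_apply]
  push_cast
  rw [← Complex.mul_conj']
  have hcc : conj c ≠ 0 := by simpa using hc0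
  have hg' : (g.normSq x (frame (fun x : D => TangentSpace 𝓘(ℂ) x) x) : ℂ) ≠ 0 := by
    exact_mod_cast hg
  field_simp
  rfl

/-- The real inner product `(A, B) = Re ⟨A, B⟩` on the fibre of `K̄_D ⊗ E` at `x`. -/
def formRe (g : HermitianMetric (fun x : D => TangentSpace 𝓘(ℂ) x)) (h : HermitianMetric E)
    (x : D) (A B : Form01 E x) : ℝ := (formInner g h x A B).re

/-- The pointwise norm squared `|φ|²` of a section of `K_D ⊗ (E^*)²`: it is
`|φ(v, ν, ν)|² / (|v|² |ν|⁴)` for any `v ≠ 0` in `T_x D` and `ν ≠ 0` in `E_x`. -/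
def twistNormSq (g : HermitianMetric (fun x : D => TangentSpace 𝓘(ℂ) x)) (h : HermitianMetric E)
    (x : D) (φ : CanonicalTwist E x) : ℝ :=
  let v := frame (fun x : D => TangentSpace 𝓘(ℂ) x) x
  let ν := frame E x
  ‖φ v ν ν‖ ^ 2 / (g.normSq x v * h.normSq x ν ^ 2)

lemma twistNormSq_eq (g : HermitianMetric (fun x : D => TangentSpace 𝓘(ℂ) x))
    (h : HermitianMetric E) (x : D) (φ : CanonicalTwist E x) (v : TangentSpace 𝓘(ℂ) x)
    (hv : v ≠ 0) (ν : E x) (hν : ν ≠ 0) :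
    twistNormSq g h x φ = ‖φ v ν ν‖ ^ 2 / (g.normSq x v * h.normSq x ν ^ 2) := by
  obtain ⟨c, hc⟩ := exists_eq_smul (E := fun x : D => TangentSpace 𝓘(ℂ) x) x
    (frame_ne_zero (E := fun x : D => TangentSpace 𝓘(ℂ) x) x) v
  have hc0 : c ≠ 0 := by rintro rfl; exact hv (by rw [hc, zero_smul])
  obtain ⟨d, hd⟩ := exists_eq_smul x (frame_ne_zero (E := E) x) ν
  have hd0 : d ≠ 0 := by rintro rfl; exact hν (by rw [hd, zero_smul])
  have hg : g.normSq x (frame (fun x : D => TangentSpace 𝓘(ℂ) x) x) ≠ 0 :=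
    (g.pos x _ (frame_ne_zero (E := fun x : D => TangentSpace 𝓘(ℂ) x) x)).ne'
  have hh : h.normSq x (frame E x) ≠ 0 := (h.pos x _ (frame_ne_zero (E := E) x)).ne'
  have hn : ‖c‖ ≠ 0 := by simpa using hc0
  have hm : ‖d‖ ≠ 0 := by simpa using hd0
  rw [hc, hd, g.normSq_smul, h.normSq_smul]
  simp only [twistNormSq, map_smul, LinearMap.smul_apply, smul_eq_mul, norm_mul]
  field_simp

variable (E) in
/-- A (not necessarily complex linear) map of real vector bundles `E → K̄_D ⊗ E`, fibrewise. -/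
abbrev RealBundleMap : Type _ := ∀ x : D, E x →ₗ[ℝ] Form01 E x

variable (E) in
/-- The bundle map `R` is smooth, as a map of total spaces. -/
def IsSmoothBundleMap (R : RealBundleMap E) : Prop :=
  ContMDiff (𝓘(ℝ, ℂ).prod 𝓘(ℝ, ℂ)) (𝓘(ℝ, ℂ).prod 𝓘(ℝ, ℂ →SL[starRingEnd ℂ] ℂ)) ∞
    (fun u : TotalSpace ℂ E =>
      TotalSpace.mk' (ℂ →SL[starRingEnd ℂ] ℂ) (E := fun x => Form01 E x) u.1 (R u.1 u.2))

/-- The pointwise adjoint `R^*` of `R` with respect to the real inner products `( , )`, written in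
the real orthogonal basis `ν, iν` of `E_x`; see `re_adjoint`. -/
def adjoint (g : HermitianMetric (fun x : D => TangentSpace 𝓘(ℂ) x)) (h : HermitianMetric E)
    (R : RealBundleMap E) (x : D) (A : Form01 E x) : E x :=
  let ν := frame E x
  ((((formRe g h x (R x ν) A : ℝ) : ℂ) +
    ((formRe g h x (R x (Complex.I • ν)) A : ℝ) : ℂ) * Complex.I) / h.normSq x ν) • ν

lemma re_adjoint (g : HermitianMetric (fun x : D => TangentSpace 𝓘(ℂ) x)) (h : HermitianMetric E)
    (R : RealBundleMap E) (x : D) (u : E x) (A : Form01 E x) :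
    h.re x u (adjoint g h R x A) = formRe g h x (R x u) A := by
  obtain ⟨c, rfl⟩ := exists_eq_smul x (frame_ne_zero (E := E) x) u
  have hh : h.normSq x (frame E x) ≠ 0 := (h.pos x _ (frame_ne_zero (E := E) x)).ne'
  have hadd : ∀ B C : Form01 E x, formRe g h x (B + C) A = formRe g h x B A + formRe g h x C A := by
    intro B C
    simp [formRe, formInner, add_div]
  have hsmul : ∀ (r : ℝ) (B : Form01 E x), formRe g h x (r • B) A = r * formRe g h x B A := by
    intro r B
    have : (r • B : Form01 E x) = (r : ℂ) • B := by
      ext v; rfl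
    rw [this]
    simp only [formRe, formInner, smul_apply, map_smul, LinearMap.smul_apply,
      smul_eq_mul]
    rw [mul_div_assoc, Complex.re_ofReal_mul]
  have hc : c • frame E x = c.re • frame E x + c.im • (Complex.I • frame E x) := by
    conv_lhs => rw [← Complex.re_add_im c]
    rw [add_smul, mul_smul]
    rfl
  conv_rhs => rw [hc, map_add, map_smul, map_smul, hadd, hsmul, hsmul]
  simp only [HermitianMetric.re, adjoint, map_smul, map_smulₛₗ, LinearMap.smul_apply, smul_eq_mul,
    h.inner_self]
  have hh' : (h.normSq x (frame E x) : ℂ) ≠ 0 := by exact_mod_cast hh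
  have : ∀ a b : ℝ, conj (((a : ℂ) + b * Complex.I) / (h.normSq x (frame E x) : ℂ)) *
      (c * (h.normSq x (frame E x) : ℂ)) = c * (a - b * Complex.I) := by
    intro a b
    simp only [map_div₀, map_add, map_mul, Complex.conj_ofReal, Complex.conj_I]
    field_simp
    ring
  rw [this]
  simp

/-- `L_t = ∂̄ + tR`. -/
def deformedDbar (t : ℝ) (R : RealBundleMap E) (ξ : ∀ x, E x) (x : D) : Form01 E x :=
  dbar ξ x + t • R x (ξ x)

/-- The kernel of `L_t : Ω⁰(E) → Ω^{0,1}(E)`. -/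
def kerDeformedDbar (t : ℝ) (R : RealBundleMap E) : Set (∀ x, E x) :=
  {ξ | IsSmoothSection ξ ∧ ∀ x, deformedDbar t R ξ x = 0}

end Forms

/-! ### The area measure and the formal adjoint `∂̄^*` -/

section Area

variable {D : Type*} [TopologicalSpace D] [ChartedSpace ℂ D] [IsManifold 𝓘(ℂ) ω D]
  [MeasurableSpace D]

/-- The area measure of `g` on the domain of the preferred chart `z` at `p`: `|∂_z|² dx dy`, where
`∂_z` is the coordinate vector field of the chart. -/
def chartArea (g : HermitianMetric (fun x : D => TangentSpace 𝓘(ℂ) x)) (p : D) : Measure D :=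
  ((volume.restrict (chartAt ℂ p).target).map (chartAt ℂ p).symm).withDensity
    (fun y => ENNReal.ofReal
      (g.normSq y (localFrame (fun x : D => TangentSpace 𝓘(ℂ) x) p y)))

/-- The area measure of `g`. The measures `chartArea g p` agree on overlaps of chart domains, and
their supremum is the measure on `D` that restricts to each of them. -/
def area (g : HermitianMetric (fun x : D => TangentSpace 𝓘(ℂ) x)) : Measure D :=
  ⨆ p : D, chartArea g p

variable {E : D → Type*} [∀ x, AddCommGroup (E x)] [∀ x, Module ℂ (E x)]
  [TopologicalSpace (TotalSpace ℂ E)] [∀ x, TopologicalSpace (E x)] [FiberBundle ℂ E]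
  [VectorBundle ℂ ℂ E] [∀ x, IsTopologicalAddGroup (E x)] [∀ x, ContinuousSMul ℂ (E x)]

/-- `∂̄^* α = σ`, for the formal `L²`-adjoint `∂̄^*` of `∂̄` on the closed surface `D`:
`∫ (∂̄ζ, α) = ∫ (ζ, σ)` for all smooth sections `ζ` of `E`. -/
def IsDbarStar (g : HermitianMetric (fun x : D => TangentSpace 𝓘(ℂ) x)) (h : HermitianMetric E)
    (α : ∀ x, Form01 E x) (σ : ∀ x, E x) : Prop :=
  ∀ ζ : ∀ x, E x, IsSmoothSection ζ →
    ∫ x, formRe g h x (dbar ζ x) (α x) ∂(area g) = ∫ x, h.re x (ζ x) (σ x) ∂(area g)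

end Area

end AntilinearDbar

end

/-! Take `ξ` in the kernel, so `∂̄ξ = -tRξ`. Pairing identity (c), applied to `ξ`, with `ξ` itself
shows that `∫ (∂̄ξ, Rξ)` equals its own negative, hence vanishes (`integral_formRe_dbar_eq_zero`).
Substituting the kernel equation and `|Rξ|² = |φ|²|ξ|²`, which is (b), gives `t ∫ |φ|²|ξ|² = 0`, so
the integral vanishes since `t ≠ 0`.

The integrand is continuous and nonnegative. The area measure is finite (`isFiniteMeasure_area`), so
the integrand is integrable and vanishes almost everywhere; the measure charges nonempty open sets
(`isOpenPosMeasure_area`), so it vanishes everywhere. By the identity theorem on the connected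
surface `D`, `φ` is nonzero on a dense set (`dense_twist_ne_zero`); there `ξ = 0`, and continuity of
`|ξ|²` gives `ξ = 0` throughout.

Both measure properties need proof because `area` is a supremum over all charts; they rest on the
chart independence `chartArea_eq`. -/

set_option linter.unusedSectionVars false

namespace AntilinearDbar

/-! ### Hermitian norms and local frames -/

section Basic

open Set Topology

variable {D : Type*} [TopologicalSpace D] [ChartedSpace ℂ D]
  {E : D → Type*} [∀ x, AddCommGroup (E x)] [∀ x, Module ℂ (E x)]
  [TopologicalSpace (TotalSpace ℂ E)] [∀ x, TopologicalSpace (E x)] [FiberBundle ℂ E]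

lemma HermitianMetric.continuous_normSq_section (h : HermitianMetric E) {ξ : ∀ x, E x} {s : Set D}
    (hξ : ContinuousOn (fun x => TotalSpace.mk' ℂ x (ξ x)) s) :
    ContinuousOn (fun x => h.normSq x (ξ x)) s :=
  h.smooth.continuous.comp_continuousOn hξ

lemma HermitianMetric.normSq_eq_zero (h : HermitianMetric E) {x : D} {u : E x} :
    h.normSq x u = 0 ↔ u = 0 := by
  refine ⟨fun h0 => by_contra fun hu => (h.pos x u hu).ne' h0, ?_⟩
  rintro rfl
  simp [HermitianMetric.normSq]

lemma HermitianMetric.normSq_nonneg (h : HermitianMetric E) (x : D) (u : E x) :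
    0 ≤ h.normSq x u := by
  by_cases hu : u = 0
  · exact (h.normSq_eq_zero.2 hu).ge
  · exact (h.pos x u hu).le

variable [VectorBundle ℂ ℂ E]

variable (E) in
lemma continuousOn_localFrame (p : D) :
    ContinuousOn (fun y => TotalSpace.mk' ℂ y (localFrame E p y))
      (trivializationAt ℂ E p).baseSet := by
  have h1 := (trivializationAt ℂ E p).continuousOn_symm.comp
    (continuousOn_id.prodMk (continuousOn_const (c := (1 : ℂ))))
    (fun y (hy : y ∈ (trivializationAt ℂ E p).baseSet) => (⟨hy, mem_univ _⟩ : (y, (1 : ℂ)) ∈ _ ×ˢ univ))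
  refine h1.congr fun y hy => ?_
  simp only [localFrame, Function.comp, Trivialization.symmL_apply _ hy]
  rfl

lemma localFrame_ne_zero {p y : D} (hy : y ∈ (trivializationAt ℂ E p).baseSet) :
    localFrame E p y ≠ 0 := by
  intro h0
  have h1 := (trivializationAt ℂ E p).continuousLinearMapAt_symmL (R := ℂ) hy 1
  have h2 : (trivializationAt ℂ E p).symmL ℂ y 1 = 0 := h0
  rw [h2, map_zero] at h1
  exact zero_ne_one h1

variable (E) in
lemma isSmoothSection_zero : IsSmoothSection (fun x => (0 : E x)) := by
  intro x
  rw [contMDiffAt_section]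
  apply (contMDiffAt_const (c := 0)).congr_of_eventuallyEq
  filter_upwards [(trivializationAt ℂ E x).open_baseSet.mem_nhds
    (FiberBundle.mem_baseSet_trivializationAt' x)] with y hy
    using congr_arg Prod.snd <| (trivializationAt ℂ E x).zeroSection ℂ hy

end Basic

/-! ### The integral identity for kernel sections -/

section Forms

variable {D : Type*} [TopologicalSpace D] [ChartedSpace ℂ D] [IsManifold 𝓘(ℂ) ω D]
  {E : D → Type*} [∀ x, AddCommGroup (E x)] [∀ x, Module ℂ (E x)]
  [TopologicalSpace (TotalSpace ℂ E)] [∀ x, TopologicalSpace (E x)] [FiberBundle ℂ E]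
  [VectorBundle ℂ ℂ E] [∀ x, IsTopologicalAddGroup (E x)] [∀ x, ContinuousSMul ℂ (E x)]

variable (E) in
lemma dbar_zero (x : D) : dbar (fun x => (0 : E x)) x = 0 := by
  have h0 : (fun y => (trivializationAt ℂ E x (TotalSpace.mk' ℂ y (0 : E y))).2)
      =ᶠ[nhds x] fun _ => 0 := by
    filter_upwards [(trivializationAt ℂ E x).open_baseSet.mem_nhds
      (FiberBundle.mem_baseSet_trivializationAt' x)] with y hy
      using congr_arg Prod.snd <| (trivializationAt ℂ E x).zeroSection ℂ hy
  have h1 : mfderiv 𝓘(ℝ, ℂ) 𝓘(ℝ, ℂ)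
      (fun y => (trivializationAt ℂ E x (TotalSpace.mk' ℂ y (0 : E y))).2) x = 0 := by
    rw [h0.mfderiv_eq]; exact mfderiv_const
  have h2 : antilinearPart 0 = 0 := by ext v; simp [antilinearPart]
  simp only [dbar]
  erw [h1, h2]
  exact ContinuousLinearMap.comp_zero _

lemma formRe_comm (g : HermitianMetric (fun x : D => TangentSpace 𝓘(ℂ) x))
    (h : HermitianMetric E) (x : D) (A B : Form01 E x) :
    formRe g h x A B = formRe g h x B A := by
  simp only [formRe, formInner]
  rw [Complex.div_ofReal_re, Complex.div_ofReal_re, ← h.conj_symm, Complex.conj_re]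

lemma formRe_neg_smul_left (g : HermitianMetric (fun x : D => TangentSpace 𝓘(ℂ) x))
    (h : HermitianMetric E) (x : D) (r : ℝ) (A B : Form01 E x) :
    formRe g h x (-(r • A)) B = -(r * formRe g h x A B) := by
  have : (-(r • A) : Form01 E x) = (-r : ℂ) • A := by
    rw [neg_smul]; rfl
  rw [this]
  simp only [formRe, formInner, smul_apply, map_smul, LinearMap.smul_apply, smul_eq_mul]
  rw [mul_div_assoc, ← Complex.ofReal_neg, Complex.re_ofReal_mul, neg_mul]

/-- The cross term `∫ (∂̄ξ, Rξ)` vanishes when `∂̄^* R + R^* ∂̄ = 0`. -/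
lemma integral_formRe_dbar_eq_zero [MeasurableSpace D]
    (g : HermitianMetric (fun x : D => TangentSpace 𝓘(ℂ) x))
    (h : HermitianMetric E) (R : RealBundleMap E) {ξ : ∀ x, E x} (hξ : IsSmoothSection ξ)
    (hRd : IsDbarStar g h (fun x => R x (ξ x)) (fun x => -adjoint g h R x (dbar ξ x))) :
    ∫ x, formRe g h x (dbar ξ x) (R x (ξ x)) ∂(area g) = 0 := by
  -- The test section is `ξ` itself. The right side becomes minus the left; `integral_neg` holds
  -- without integrability.
  have h1 := hRd ξ hξ
  have h2 : ∀ x, h.re x (ξ x) (-adjoint g h R x (dbar ξ x)) =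
      -formRe g h x (dbar ξ x) (R x (ξ x)) := by
    intro x
    rw [formRe_comm, ← re_adjoint]
    simp [HermitianMetric.re]
  simp only [h2, integral_neg] at h1
  linarith

/-- By adjointness `(Ru, Ru) = (u, R^*Ru)`. Condition (b) supplies `r = |φ|²`. -/
lemma formRe_self_eq (g : HermitianMetric (fun x : D => TangentSpace 𝓘(ℂ) x))
    (h : HermitianMetric E) (R : RealBundleMap E) (x : D) (u : E x) (r : ℝ)
    (hr : adjoint g h R x (R x u) = r • u) :
    formRe g h x (R x u) (R x u) = r * h.normSq x u := by
  rw [← re_adjoint, hr]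
  have : (r • u : E x) = (r : ℂ) • u := rfl
  rw [HermitianMetric.re, this, map_smulₛₗ, h.inner_self]
  simp

/-- The integrand `|φ|²|ξ|²` has integral zero for `ξ` in the kernel of `L_t`. -/
lemma integral_twistNormSq_mul_normSq_eq_zero [MeasurableSpace D]
    (g : HermitianMetric (fun x : D => TangentSpace 𝓘(ℂ) x)) (h : HermitianMetric E)
    (φ : ∀ x : D, CanonicalTwist E x) (R : RealBundleMap E)
    (hRR : ∀ (x : D) (u : E x), adjoint g h R x (R x u) = twistNormSq g h x (φ x) • u)
    {t : ℝ} (ht : t ≠ 0) {ξ : ∀ x, E x} (hξ : ξ ∈ kerDeformedDbar t R)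
    (hRd : IsDbarStar g h (fun x => R x (ξ x)) (fun x => -adjoint g h R x (dbar ξ x))) :
    ∫ x, twistNormSq g h x (φ x) * h.normSq x (ξ x) ∂(area g) = 0 := by
  have h1 := integral_formRe_dbar_eq_zero g h R hξ.1 hRd
  have h2 : ∀ x, formRe g h x (dbar ξ x) (R x (ξ x)) =
      -t * (twistNormSq g h x (φ x) * h.normSq x (ξ x)) := by
    intro x
    rw [eq_neg_of_add_eq_zero_left (hξ.2 x), formRe_neg_smul_left,
      formRe_self_eq g h R x _ _ (hRR x _)]
    ring
  simp only [h2, integral_const_mul] at h1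
  exact (mul_eq_zero.1 h1).resolve_left (neg_ne_zero.2 ht)

end Forms

/-! ### Finiteness and positivity of the area measure -/

section Area

open Set Topology

variable {D : Type*} [TopologicalSpace D] [ChartedSpace ℂ D] [IsManifold 𝓘(ℂ) ω D]

/-- The coordinate vector fields of two charts differ by the derivative of the transition map. -/
lemma localFrame_tangent_eq_smul {p q y : D} (hp : y ∈ (chartAt ℂ p).source)
    (hq : y ∈ (chartAt ℂ q).source) :
    localFrame (fun x : D => TangentSpace 𝓘(ℂ) x) p y =
      deriv (chartAt ℂ q ∘ (chartAt ℂ p).symm) (chartAt ℂ p y) •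
        localFrame (fun x : D => TangentSpace 𝓘(ℂ) x) q y := by
  -- The cocycle identity for the charts at `p`, `q`, `y`: vectors over `y` are read in the
  -- preferred chart at `y`.
  have h1 := (tangentBundleCore 𝓘(ℂ) D).coordChange_comp (achart ℂ p) (achart ℂ q) (achart ℂ y) y
    ⟨⟨hp, hq⟩, mem_chart_source ℂ y⟩ 1
  have h2 : (tangentBundleCore 𝓘(ℂ) D).coordChange (achart ℂ p) (achart ℂ q) y 1 =
      deriv (chartAt ℂ q ∘ (chartAt ℂ p).symm) (chartAt ℂ p y) • (1 : ℂ) := by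
    rw [tangentBundleCore_coordChange_achart]
    simp [fderivWithin_univ]
  rw [h2, map_smul] at h1
  simp only [localFrame]
  rw [TangentBundle.symmL_trivializationAt_eq_core hp, TangentBundle.symmL_trivializationAt_eq_core hq]
  exact h1.symm

lemma differentiableAt_transition {p q y : D} (hp : y ∈ (chartAt ℂ p).source)
    (hq : y ∈ (chartAt ℂ q).source) :
    DifferentiableAt ℂ (chartAt ℂ q ∘ (chartAt ℂ p).symm) (chartAt ℂ p y) := by
  have h1 : MDifferentiableAt 𝓘(ℂ) 𝓘(ℂ) (chartAt ℂ p).symm (chartAt ℂ p y) :=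
    mdifferentiableAt_atlas_symm (chart_mem_atlas ℂ p) ((chartAt ℂ p).map_source hp)
  have h2 : MDifferentiableAt 𝓘(ℂ) 𝓘(ℂ) (chartAt ℂ q) ((chartAt ℂ p).symm (chartAt ℂ p y)) := by
    rw [(chartAt ℂ p).left_inv hp]
    exact mdifferentiableAt_atlas (chart_mem_atlas ℂ q) hq
  exact (h2.comp _ h1).differentiableAt

/-- The real Jacobian of a holomorphic map with derivative `c` is `|c|²`. -/
lemma det_restrictScalars_toSpanSingleton (c : ℂ) :
    ((ContinuousLinearMap.toSpanSingleton ℂ c).restrictScalars ℝ : ℂ →L[ℝ] ℂ).det = ‖c‖ ^ 2 := by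
  simp [ContinuousLinearMap.det, LinearMap.det_restrictScalars, Algebra.norm_complex_eq,
    Complex.normSq_eq_norm_sq]

variable [MeasurableSpace D] [BorelSpace D]
  (g : HermitianMetric (fun x : D => TangentSpace 𝓘(ℂ) x))

lemma continuousOn_normSq_localFrame (p : D) :
    ContinuousOn (fun y => g.normSq y (localFrame (fun x : D => TangentSpace 𝓘(ℂ) x) p y))
      (chartAt ℂ p).source :=
  g.continuous_normSq_section (continuousOn_localFrame (fun x : D => TangentSpace 𝓘(ℂ) x) p)

lemma aemeasurable_chart_symm (p : D) :
    AEMeasurable (chartAt ℂ p).symm (volume.restrict (chartAt ℂ p).target) :=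
  (chartAt ℂ p).continuousOn_symm.aemeasurable (chartAt ℂ p).open_target.measurableSet

lemma chartArea_compl_source (p : D) : chartArea g p (chartAt ℂ p).sourceᶜ = 0 := by
  refine withDensity_absolutelyContinuous _ _ ?_
  rw [Measure.map_apply_of_aemeasurable (aemeasurable_chart_symm p)
    (chartAt ℂ p).open_source.measurableSet.compl,
    Measure.restrict_apply₀' (chartAt ℂ p).open_target.measurableSet.nullMeasurableSet]
  convert measure_empty (μ := (volume : Measure ℂ))
  ext z
  simp only [mem_inter_iff, mem_preimage, mem_compl_iff, mem_empty_iff_false, iff_false, not_and]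
  intro hz hz'
  exact hz ((chartAt ℂ p).map_target hz')

lemma measurableSet_chart_image {p : D} {S : Set D} (hS : MeasurableSet S)
    (hp : S ⊆ (chartAt ℂ p).source) : MeasurableSet (chartAt ℂ p '' S) := by
  have h1 : chartAt ℂ p '' S = (chartAt ℂ p).target ∩ (chartAt ℂ p).symm ⁻¹' S :=
    (chartAt ℂ p).image_eq_target_inter_inv_preimage hp
  have h2 : Measurable ((chartAt ℂ p).target.domRestrict (chartAt ℂ p).symm) :=
    (continuousOn_iff_continuous_domRestrict.1 (chartAt ℂ p).continuousOn_symm).measurable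
  have h3 := (MeasurableEmbedding.subtype_coe
    (chartAt ℂ p).open_target.measurableSet).measurableSet_image.2 (h2 hS)
  convert h3 using 1
  rw [h1]
  ext z
  simp [domRestrict_apply, and_comm]

lemma chartArea_apply {p : D} {S : Set D} (hS : MeasurableSet S) (hp : S ⊆ (chartAt ℂ p).source) :
    chartArea g p S = ∫⁻ z in chartAt ℂ p '' S, ENNReal.ofReal (g.normSq ((chartAt ℂ p).symm z)
      (localFrame (fun x : D => TangentSpace 𝓘(ℂ) x) p ((chartAt ℂ p).symm z))) := by
  have hm := aemeasurable_chart_symm p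
  have hpre : NullMeasurableSet ((chartAt ℂ p).symm ⁻¹' S) (volume.restrict (chartAt ℂ p).target) :=
    hm.nullMeasurableSet_preimage hS
  have himg : chartAt ℂ p '' S = (chartAt ℂ p).symm ⁻¹' S ∩ (chartAt ℂ p).target := by
    rw [(chartAt ℂ p).image_eq_target_inter_inv_preimage hp, inter_comm]
  have hres : ((volume.restrict (chartAt ℂ p).target).map (chartAt ℂ p).symm).restrict S =
      (volume.restrict (chartAt ℂ p '' S)).map (chartAt ℂ p).symm := by
    rw [Measure.restrict_map_of_aemeasurable hm hS, Measure.restrict_restrict₀ hpre, ← himg]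
  rw [chartArea, withDensity_apply _ hS, hres, lintegral_map']
  · rw [← hres]
    exact (ENNReal.continuous_ofReal.comp_continuousOn
      ((continuousOn_normSq_localFrame g p).mono hp)).aemeasurable hS
  · exact hm.mono_measure (Measure.restrict_mono_set _ (himg ▸ inter_subset_right))

/-- Under the transition map with derivative `c`, Lebesgue measure scales by `|c|²`, and `|∂_z|² =
|c|² |∂_w|²` compensates exactly. -/
lemma chartArea_eq {p q : D} {S : Set D} (hS : MeasurableSet S) (hp : S ⊆ (chartAt ℂ p).source)
    (hq : S ⊆ (chartAt ℂ q).source) : chartArea g p S = chartArea g q S := by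
  have himg : chartAt ℂ q '' S = (chartAt ℂ q ∘ (chartAt ℂ p).symm) '' (chartAt ℂ p '' S) := by
    rw [image_image]
    exact image_congr fun y hy => by simp [(chartAt ℂ p).left_inv (hp hy)]
  rw [chartArea_apply g hS hp, chartArea_apply g hS hq, himg,
    lintegral_image_eq_lintegral_abs_det_fderiv_mul volume (measurableSet_chart_image hS hp)
      (f' := fun z => (ContinuousLinearMap.toSpanSingleton ℂ
        (deriv (chartAt ℂ q ∘ (chartAt ℂ p).symm) z)).restrictScalars ℝ)]
  · refine setLIntegral_congr_fun (measurableSet_chart_image hS hp) ?_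
    rintro _ ⟨y, hy, rfl⟩
    simp only [Function.comp]
    rw [(chartAt ℂ p).left_inv (hp hy), (chartAt ℂ q).left_inv (hq hy)]
    rw [det_restrictScalars_toSpanSingleton, localFrame_tangent_eq_smul (hp hy) (hq hy),
      g.normSq_smul, abs_of_nonneg (by positivity), ENNReal.ofReal_mul (by positivity)]
  · rintro _ ⟨y, hy, rfl⟩
    exact ((differentiableAt_transition (hp hy) (hq hy)).hasDerivAt.hasFDerivAt.restrictScalars
      ℝ).hasFDerivWithinAt
  · rintro _ ⟨y, hy, rfl⟩ _ ⟨z, hz, rfl⟩ h1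
    simp only [Function.comp, (chartAt ℂ p).left_inv (hp hy), (chartAt ℂ p).left_inv (hp hz)] at h1
    rw [(chartAt ℂ q).injOn (hq hy) (hq hz) h1]

lemma chartArea_lt_top_of_isCompact {p : D} {K : Set D} (hK : IsCompact K) (hKm : MeasurableSet K)
    (hp : K ⊆ (chartAt ℂ p).source) : chartArea g p K < ⊤ := by
  have hK' : IsCompact (chartAt ℂ p '' K) := hK.image_of_continuousOn ((chartAt ℂ p).continuousOn.mono hp)
  obtain ⟨C, hC⟩ := (hK.bddAbove_image ((continuousOn_normSq_localFrame g p).mono hp))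
  rw [chartArea_apply g hKm hp]
  refine (setLIntegral_mono measurable_const (g := fun _ => ENNReal.ofReal C) ?_).trans_lt ?_
  · rintro _ ⟨y, hy, rfl⟩
    rw [(chartAt ℂ p).left_inv (hp hy)]
    exact ENNReal.ofReal_le_ofReal (hC ⟨y, hy, rfl⟩)
  · rw [setLIntegral_const]
    exact ENNReal.mul_lt_top ENNReal.ofReal_lt_top hK'.measure_lt_top

/-- Finitely many compact sets `K p`, each inside a chart domain, cover `D`. Chart independence
bounds every `chartArea g q` by the same finite sum over these sets, hence bounds the supremum. -/
instance isFiniteMeasure_area [T2Space D] [CompactSpace D] : IsFiniteMeasure (area g) := by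
  have : LocallyCompactSpace D := ChartedSpace.locallyCompactSpace ℂ D
  have h1 : ∀ p : D, ∃ K : Set D, IsCompact K ∧ K ∈ 𝓝 p ∧ K ⊆ (chartAt ℂ p).source := fun p => by
    obtain ⟨K, hK, hKs, hKc⟩ := local_compact_nhds (chart_source_mem_nhds ℂ p)
    exact ⟨K, hKc, hK, hKs⟩
  choose K hKc hKn hKs using h1
  obtain ⟨t, ht⟩ := CompactSpace.elim_nhds_subcover K hKn
  have h2 : area g ≤ ∑ p ∈ t, (chartArea g p).restrict (K p) := by
    refine iSup_le fun q => Measure.le_iff.2 fun S hS => ?_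
    have hsub : S ⊆ (⋃ p ∈ t, S ∩ K p ∩ (chartAt ℂ q).source) ∪ (chartAt ℂ q).sourceᶜ := by
      intro y hy
      by_cases hq : y ∈ (chartAt ℂ q).source
      · have := ht.ge (mem_univ y)
        simp only [mem_iUnion] at this
        obtain ⟨p, hp, hyp⟩ := this
        exact Or.inl (mem_biUnion hp ⟨⟨hy, hyp⟩, hq⟩)
      · exact Or.inr hq
    calc chartArea g q S
        ≤ chartArea g q (⋃ p ∈ t, S ∩ K p ∩ (chartAt ℂ q).source)
          + chartArea g q (chartAt ℂ q).sourceᶜ := (measure_mono hsub).trans (measure_union_le _ _)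
      _ ≤ ∑ p ∈ t, chartArea g q (S ∩ K p ∩ (chartAt ℂ q).source) := by
          rw [chartArea_compl_source, add_zero]
          exact measure_biUnion_finset_le _ _
      _ ≤ ∑ p ∈ t, (chartArea g p).restrict (K p) S := by
          refine Finset.sum_le_sum fun p _ => ?_
          -- The piece lies in both chart domains, so it may be measured in the chart at `p`.
          rw [← chartArea_eq g (p := p)
            ((hS.inter (hKc p).measurableSet).inter (chartAt ℂ q).open_source.measurableSet)
            (fun y hy => hKs p hy.1.2) (fun y hy => hy.2), Measure.restrict_apply hS]
          exact measure_mono inter_subset_left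
      _ = (∑ p ∈ t, (chartArea g p).restrict (K p)) S := by
          rw [Measure.finsetSum_apply]
  refine ⟨(h2 univ).trans_lt ?_⟩
  rw [Measure.finsetSum_apply]
  refine ENNReal.sum_lt_top.2 fun p _ => ?_
  rw [Measure.restrict_apply MeasurableSet.univ, univ_inter]
  exact chartArea_lt_top_of_isCompact g (hKc p) (hKc p).measurableSet (hKs p)

/-- A single chart measure is a lower bound for `area`, and its density `|∂_z|²` is strictly
positive on the chart domain. -/
instance isOpenPosMeasure_area : (area g).IsOpenPosMeasure := by
  refine ⟨fun U hU hne h0 => ?_⟩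
  obtain ⟨p, hp⟩ := hne
  set S := U ∩ (chartAt ℂ p).source with hS
  have hSo : IsOpen S := hU.inter (chartAt ℂ p).open_source
  have hSs : S ⊆ (chartAt ℂ p).source := inter_subset_right
  have h1 : chartArea g p S = 0 :=
    le_antisymm (((le_iSup (chartArea g) p) S).trans
      ((measure_mono inter_subset_left).trans h0.le)) zero_le
  have himg : IsOpen (chartAt ℂ p '' S) := (chartAt ℂ p).isOpen_image_of_subset_source hSo hSs
  rw [chartArea_apply g hSo.measurableSet hSs] at h1
  have hm : AEMeasurable (fun z => ENNReal.ofReal (g.normSq ((chartAt ℂ p).symm z)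
      (localFrame (fun x : D => TangentSpace 𝓘(ℂ) x) p ((chartAt ℂ p).symm z))))
      (volume.restrict (chartAt ℂ p '' S)) := by
    refine ContinuousOn.aemeasurable ?_ himg.measurableSet
    refine ENNReal.continuous_ofReal.comp_continuousOn ?_
    refine (continuousOn_normSq_localFrame g p).comp
      ((chartAt ℂ p).continuousOn_symm.mono ?_) ?_
    · rintro _ ⟨y, hy, rfl⟩
      exact (chartAt ℂ p).map_source (hSs hy)
    · rintro _ ⟨y, hy, rfl⟩
      rw [(chartAt ℂ p).left_inv (hSs hy)]
      exact hSs hy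
  rw [lintegral_eq_zero_iff' hm, Filter.EventuallyEq, ae_restrict_iff' himg.measurableSet] at h1
  refine (himg.measure_pos volume ⟨_, mem_image_of_mem _ ⟨hp, mem_chart_source ℂ p⟩⟩).ne' ?_
  refine measure_mono_null ?_ h1
  rintro _ ⟨y, hy, rfl⟩ h2
  have h3 := h2 ⟨y, hy, rfl⟩
  rw [(chartAt ℂ p).left_inv (hSs hy)] at h3
  exact absurd (ENNReal.ofReal_eq_zero.1 h3)
    (not_le.2 (g.pos y _ (localFrame_ne_zero (E := fun x : D => TangentSpace 𝓘(ℂ) x) (hSs hy))))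

end Area
-- Zeros of the holomorphic section
section Twist

open Set Topology

variable {D : Type*} [TopologicalSpace D] [ChartedSpace ℂ D] [IsManifold 𝓘(ℂ) ω D]
  {E : D → Type*} [∀ x, AddCommGroup (E x)] [∀ x, Module ℂ (E x)]
  [TopologicalSpace (TotalSpace ℂ E)] [∀ x, TopologicalSpace (E x)] [FiberBundle ℂ E]
  [VectorBundle ℂ ℂ E] [∀ x, IsTopologicalAddGroup (E x)] [∀ x, ContinuousSMul ℂ (E x)]

/-- The coefficient `φ(∂_z, ν, ν)` in the preferred coordinate and frame at `p`. -/
noncomputable def twistCoeff (φ : ∀ x : D, CanonicalTwist E x) (p y : D) : ℂ :=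
  φ y (localFrame (fun x : D => TangentSpace 𝓘(ℂ) x) p y) (localFrame E p y) (localFrame E p y)

variable (E) in
/-- The common domain of the preferred coordinate and frame at `p`. -/
def frameDomain (p : D) : Set D := (chartAt ℂ p).source ∩ (trivializationAt ℂ E p).baseSet

lemma isOpen_frameDomain (p : D) : IsOpen (frameDomain E p) :=
  (chartAt ℂ p).open_source.inter (trivializationAt ℂ E p).open_baseSet

lemma mem_frameDomain (p : D) : p ∈ frameDomain E p :=
  ⟨mem_chart_source ℂ p, FiberBundle.mem_baseSet_trivializationAt' p⟩

lemma twistCoeff_eq_zero_iff (φ : ∀ x : D, CanonicalTwist E x) {p y : D}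
    (hy : y ∈ frameDomain E p) : twistCoeff φ p y = 0 ↔ φ y = 0 := by
  refine ⟨fun h0 => ?_, fun h0 => by simp [twistCoeff, h0]⟩
  refine LinearMap.ext fun v => LinearMap.ext fun u => LinearMap.ext fun w => ?_
  obtain ⟨a, rfl⟩ := exists_eq_smul (E := fun x : D => TangentSpace 𝓘(ℂ) x) y
    (localFrame_ne_zero (E := fun x : D => TangentSpace 𝓘(ℂ) x) (p := p) hy.1) v
  obtain ⟨b, rfl⟩ := exists_eq_smul y (localFrame_ne_zero (E := E) hy.2) u
  obtain ⟨c, rfl⟩ := exists_eq_smul y (localFrame_ne_zero (E := E) hy.2) w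
  simp only [map_smul, LinearMap.smul_apply]
  change c • b • a • twistCoeff φ p y = c • b • a • (0 : ℂ)
  rw [h0]

/-- `twistNormSq` uses at each point the frame chosen there, which need not vary continuously. By
`twistNormSq_eq` one continuous local frame may be used near `p` instead. -/
lemma continuous_twistNormSq (g : HermitianMetric (fun x : D => TangentSpace 𝓘(ℂ) x))
    (h : HermitianMetric E) {φ : ∀ x : D, CanonicalTwist E x} (hφ : IsHolomorphicTwist E φ) :
    Continuous (fun x => twistNormSq g h x (φ x)) := by
  refine continuous_iff_continuousAt.2 fun p => ?_
  have h1 : ContinuousOn (fun y => ‖twistCoeff φ p y‖ ^ 2 /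
      (g.normSq y (localFrame (fun x : D => TangentSpace 𝓘(ℂ) x) p y) *
        h.normSq y (localFrame E p y) ^ 2)) (frameDomain E p) := by
    refine ((hφ p).continuousOn.norm.pow 2).div (((g.continuous_normSq_section
      (continuousOn_localFrame (fun x : D => TangentSpace 𝓘(ℂ) x) p)).mono inter_subset_left).mul
      (((h.continuous_normSq_section (continuousOn_localFrame E p)).mono inter_subset_right).pow 2))
      fun y hy => ?_
    exact mul_ne_zero (g.pos y _ (localFrame_ne_zero (E := fun x : D => TangentSpace 𝓘(ℂ) x) hy.1)).ne'
      (pow_ne_zero _ (h.pos y _ (localFrame_ne_zero hy.2)).ne')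
  have hn : frameDomain E p ∈ 𝓝 p := (isOpen_frameDomain p).mem_nhds (mem_frameDomain p)
  refine (h1.continuousAt hn).congr ?_
  filter_upwards [hn] with y hy
  exact (twistNormSq_eq g h y (φ y) _
    (localFrame_ne_zero (E := fun x : D => TangentSpace 𝓘(ℂ) x) hy.1) _
    (localFrame_ne_zero hy.2)).symm

lemma twistNormSq_nonneg (g : HermitianMetric (fun x : D => TangentSpace 𝓘(ℂ) x))
    (h : HermitianMetric E) (x : D) (φ : CanonicalTwist E x) : 0 ≤ twistNormSq g h x φ :=
  div_nonneg (sq_nonneg _) (mul_nonneg (g.normSq_nonneg x _) (sq_nonneg _))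

lemma twistNormSq_eq_zero_iff (g : HermitianMetric (fun x : D => TangentSpace 𝓘(ℂ) x))
    (h : HermitianMetric E) (φ : ∀ x : D, CanonicalTwist E x) (x : D) :
    twistNormSq g h x (φ x) = 0 ↔ φ x = 0 := by
  rw [← twistCoeff_eq_zero_iff φ (mem_frameDomain x)]
  have hg : g.normSq x (frame (fun x : D => TangentSpace 𝓘(ℂ) x) x) ≠ 0 :=
    mt g.normSq_eq_zero.1 (frame_ne_zero (E := fun x : D => TangentSpace 𝓘(ℂ) x) x)
  have hh : h.normSq x (frame E x) ≠ 0 := mt h.normSq_eq_zero.1 (frame_ne_zero (E := E) x)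
  rw [twistNormSq, div_eq_zero_iff, or_iff_left (mul_ne_zero hg (pow_ne_zero _ hh)), sq_eq_zero_iff,
    norm_eq_zero]
  rfl

/-- A holomorphic section vanishing at points accumulating at `p` vanishes near `p`. -/
lemma eventually_twist_eq_zero {φ : ∀ x : D, CanonicalTwist E x} (hφ : IsHolomorphicTwist E φ)
    {p : D} (hp : p ∈ closure (interior {x | φ x = 0})) : ∀ᶠ x in 𝓝 p, φ x = 0 := by
  set e := chartAt ℂ p
  have hpe : p ∈ e.source := mem_chart_source ℂ p
  set W := e.target ∩ e.symm ⁻¹' frameDomain E p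
  have hW : IsOpen W := e.isOpen_inter_preimage_symm (isOpen_frameDomain p)
  have hpW : e p ∈ W := ⟨e.map_source hpe, by
    rw [mem_preimage, e.left_inv hpe]; exact mem_frameDomain p⟩
  have hd : DifferentiableOn ℂ (twistCoeff φ p ∘ e.symm) W := by
    rw [← mdifferentiableOn_iff_differentiableOn]
    exact (hφ p).comp ((mdifferentiableOn_atlas_symm (chart_mem_atlas ℂ p)).mono inter_subset_left)
      inter_subset_right
  have hn : frameDomain E p ∈ 𝓝 p := (isOpen_frameDomain p).mem_nhds (mem_frameDomain p)
  have hback : (∀ᶠ z in 𝓝 (e p), (twistCoeff φ p ∘ e.symm) z = 0) → ∀ᶠ x in 𝓝 p, φ x = 0 := by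
    intro h0
    filter_upwards [(e.continuousAt hpe).eventually h0, hn] with y hy hy'
    rwa [Function.comp, e.left_inv hy'.1, twistCoeff_eq_zero_iff φ hy'] at hy
  -- The local coefficient either vanishes near `e p` or has at most an isolated zero there.
  rcases (hd.analyticAt (hW.mem_nhds hpW)).eventually_eq_zero_or_eventually_ne_zero with h0 | h0
  · exact hback h0
  · by_cases hpi : p ∈ interior {x | φ x = 0}
    · exact mem_interior_iff_mem_nhds.1 hpi
    have h1 : ∀ᶠ y in 𝓝 p, y ≠ p → φ y ≠ 0 := by
      filter_upwards [(e.continuousAt hpe).eventually (eventually_nhdsWithin_iff.1 h0), hn]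
        with y hy hy' hne h2
      refine hy (fun h3 => hne (e.injOn hy'.1 hpe h3)) ?_
      rw [Function.comp, e.left_inv hy'.1, twistCoeff_eq_zero_iff φ hy', h2]
    -- If `p` were outside the interior, interior points near `p` would be zeros of `φ` different
    -- from `p`.
    obtain ⟨y, hy, hyi⟩ := (mem_closure_iff_frequently.1 hp).and_eventually h1 |>.exists
    exact absurd (interior_subset hy) (hyi fun h2 => hpi (h2 ▸ hy))

/-- The complement of the zero set of a nonzero holomorphic section is dense. -/
lemma dense_twist_ne_zero [ConnectedSpace D] {φ : ∀ x : D, CanonicalTwist E x}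
    (hφ : IsHolomorphicTwist E φ) (hφ0 : ∃ x, φ x ≠ 0) : Dense {x | φ x ≠ 0} := by
  have hcl : IsClopen (interior {x | φ x = 0}) := by
    refine ⟨isClosed_of_closure_subset fun p hp => ?_, isOpen_interior⟩
    exact mem_interior_iff_mem_nhds.2 (eventually_twist_eq_zero hφ hp)
  rcases isClopen_iff.1 hcl with h0 | h0
  · rw [interior_eq_empty_iff_dense_compl] at h0
    exact h0
  · obtain ⟨x, hx⟩ := hφ0
    exact absurd (interior_subset (h0 ▸ mem_univ x : x ∈ interior {x | φ x = 0})) hx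

end Twist

end AntilinearDbar

/-! ### Vanishing of the kernel -/

open AntilinearDbar in
theorem mainTheorem11
    {D : Type*} [TopologicalSpace D] [T2Space D] [CompactSpace D] [ConnectedSpace D]
    [ChartedSpace ℂ D] [IsManifold 𝓘(ℂ) ω D] [MeasurableSpace D] [BorelSpace D]
    {N : D → Type*} [∀ x, AddCommGroup (N x)] [∀ x, Module ℂ (N x)]
    [TopologicalSpace (TotalSpace ℂ N)] [∀ x, TopologicalSpace (N x)]
    [∀ x, IsTopologicalAddGroup (N x)] [∀ x, ContinuousSMul ℂ (N x)]
    [FiberBundle ℂ N] [VectorBundle ℂ ℂ N] [ContMDiffVectorBundle ω ℂ N 𝓘(ℂ)]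
    (g : HermitianMetric (fun x : D => TangentSpace 𝓘(ℂ) x)) (h : HermitianMetric N)
    (φ : ∀ x : D, CanonicalTwist N x) (hφ : IsHolomorphicTwist N φ) (hφ0 : ∃ x, φ x ≠ 0)
    (R : RealBundleMap N) (hR : IsSmoothBundleMap N R)
    (hRJ : ∀ (x : D) (u : N x), R x (Complex.I • u) = -(Complex.I • R x u))
    (hRR : ∀ (x : D) (u : N x),
      AntilinearDbar.adjoint g h R x (R x u) = twistNormSq g h x (φ x) • u)
    (hRd : ∀ ξ : ∀ x, N x, IsSmoothSection ξ →
      IsDbarStar g h (fun x => R x (ξ x))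
        (fun x => -AntilinearDbar.adjoint g h R x (dbar ξ x)))
    (t : ℝ) (ht : t ≠ 0) :
    kerDeformedDbar t R = {0} := by
  refine Set.eq_singleton_iff_unique_mem.2 ⟨⟨isSmoothSection_zero N, fun x => ?_⟩, fun ξ hξ => ?_⟩
  · have h1 : R x ((0 : ∀ x, N x) x) = 0 := (R x).map_zero
    rw [deformedDbar, h1, smul_zero, add_zero]
    exact dbar_zero N x
  have hξc : Continuous fun x => h.normSq x (ξ x) :=
    h.smooth.continuous.comp (ContMDiff.continuous hξ.1)
  have hc : Continuous fun x => twistNormSq g h x (φ x) * h.normSq x (ξ x) :=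
    (continuous_twistNormSq g h hφ).mul hξc
  -- Integrability is essential: the integral of a non-integrable function is zero by default, so
  -- `h1` alone would carry no information.
  have hint : Integrable (fun x => twistNormSq g h x (φ x) * h.normSq x (ξ x)) (area g) :=
    integrableOn_univ.1 (hc.continuousOn.integrableOn_compact isCompact_univ)
  have h1 := integral_twistNormSq_mul_normSq_eq_zero g h φ R hRR ht hξ (hRd ξ hξ.1)
  rw [integral_eq_zero_iff_of_nonneg (fun x => mul_nonneg (twistNormSq_nonneg g h x _)
    (h.normSq_nonneg x _)) hint, hc.ae_eq_iff_eq (area g) continuous_zero] at h1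
  have h2 : (fun x => h.normSq x (ξ x)) = fun _ => 0 :=
    hξc.ext_on (dense_twist_ne_zero hφ hφ0) continuous_const fun x hx =>
      (mul_eq_zero.1 (congrFun h1 x)).resolve_left
        (mt (twistNormSq_eq_zero_iff g h φ x).1 hx)
  funext x
  exact h.normSq_eq_zero.1 (congrFun h2 x)
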